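/- **Holevo bound.** Let $\mathcal H$ be a finite-dimensional complex Hilbert space and $\mathcal X$ a nonempty finite set. A *state* is a positive operator on $\mathcal H$ of trace $1$; a *cq-channel* is a map $W:x\mapsto W_x$ from $\mathcal X$ to the states on $\mathcal H$; an *observable* with finite index set $\mathcal Y$ is a family $D=(D_y)_{y\in\mathcal Y}$ of positive operators on $\mathcal H$ with $\sum_y D_y=\mathbb 1$. Logarithms are to base $2$, and $H$ denotes the Shannon entropy of a probability distribution and the von Neumann entropy of a state (the Shannon entropy of its list of eigenvalues, counted with multiplicity). For a probability distribution $P$ on $\mathcal X$ put $$I(P;W)=H\Big(\sum_x P(x)W_x\Big)-\sum_x P(x)H(W_x),\qquad C(W)=\max_P I(P;W).$$ The composition $D\circ W$ is the classical channel from $\mathcal X$ to $\mathcal Y$ with transition probabilities $(D\circ W)(y|x)=\operatorname{Tr}(W_xD_y)$. For a classical channel $V$ from $\mathcal X$ to $\mathcal Y$, $$I(P;V)=H\Big(\sum_x P(x)V(\cdot|x)\Big)-\sum_x P(x)H(V(\cdot|x)).$$ Let $C_1=\max_{P,D} I(P;D\circ W)$, over all probability distributions $P$ on $\mathcal X$ and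 all observables $D$ on $\mathcal H$ with a finite index set. Then for every cq-channel $W$, every probability distribution $P$ on $\mathcal X$ and every observable $D$ with a finite index set, $$I(P;D\circ W)\le I(P;W).$$ The maxima defining $C(W)$ and $C_1$ exist, and consequently $$C_1\le C(W).$$ -/

import Mathlib

noncomputable section

namespace CQ

/-- A probability distribution on a finite set. -/
abbrev Dist (X : Type*) [Fintype X] : Type _ := stdSimplex ℝ X

/-- A classical channel (stochastic matrix) `X → Y`: for each input a distribution on the outputs. -/
abbrev ClassicalChannel (X Y : Type*) [Fintype Y] : Type _ := X → Dist Y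

/-- The expression `-∑ p log p`, logarithm to base `2`, with `0 log 0 = 0`. -/
def entropySum {Y : Type*} [Fintype Y] (p : Y → ℝ) : ℝ :=
  -∑ y, p y * Real.logb 2 (p y)

/-- Shannon entropy (in bits) of a distribution. -/
def shannonEntropy {Y : Type*} [Fintype Y] (P : Dist Y) : ℝ :=
  entropySum (P : Y → ℝ)

/-- The output distribution `PV`, `(PV)(y) = ∑ₓ P(x) V(y|x)`. -/
def outputDist {X Y : Type*} [Fintype X] [Fintype Y] (P : Dist X) (V : ClassicalChannel X Y) :
    Dist Y :=
  ⟨fun y => ∑ x, P x * V x y, by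
    refine ⟨fun y => Finset.sum_nonneg fun x _ => mul_nonneg (P.2.1 x) ((V x).2.1 y), ?_⟩
    rw [Finset.sum_comm]
    have h : ∀ x, ∑ y, P x * V x y = P x := fun x => by
      rw [← Finset.mul_sum]
      have : ∑ y, V x y = 1 := (V x).2.2
      rw [this, mul_one]
    simp only [h]
    exact P.2.2⟩

/-- Mutual information `I(P;V) = H(PV) - ∑ₓ P(x) H(V(·|x))` of a classical channel. -/
def classicalMutualInfo {X Y : Type*} [Fintype X] [Fintype Y] (P : Dist X)
    (V : ClassicalChannel X Y) : ℝ :=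
  shannonEntropy (outputDist P V) - ∑ x, P x * shannonEntropy (V x)

section Quantum

variable (H : Type*) [NormedAddCommGroup H] [InnerProductSpace ℂ H] [FiniteDimensional ℂ H]

/-- A state (density operator) on the finite-dimensional Hilbert space `H`. -/
structure State where
  /-- the underlying operator -/
  op : H →ₗ[ℂ] H
  pos : op.IsPositive
  trace_eq_one : LinearMap.trace ℂ H op = 1

/-- An observable indexed by `Y`: a partition of the identity into positive operators. -/
structure Observable (Y : Type*) [Fintype Y] where
  /-- the operators of the observable -/
  op : Y → H →ₗ[ℂ] H
  pos : ∀ y, (op y).IsPositive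
  sum_eq_one : ∑ y, op y = 1

/-- A classical-quantum channel: a map from the input alphabet to the states on `H`. -/
abbrev CQChannel (X : Type*) : Type _ := X → State H

variable {H}

/-- Von Neumann entropy (in bits): the entropy of the list of eigenvalues with multiplicity. -/
def vonNeumannEntropy (ρ : State H) : ℝ :=
  entropySum (ρ.pos.isSymmetric.eigenvalues (rfl : Module.finrank ℂ H = Module.finrank ℂ H))

/-- The average state `PW = ∑ₓ P(x) Wₓ`. -/
def averageState {X : Type*} [Fintype X] (P : Dist X) (W : CQChannel H X) : State H where
  op := ∑ x, ((P x : ℝ) : ℂ) • (W x).op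
  pos := by
    classical
    refine Finset.sum_induction _ LinearMap.IsPositive (fun _ _ => LinearMap.IsPositive.add)
      LinearMap.isPositive_zero fun x _ => (W x).pos.smul_of_nonneg ?_
    exact_mod_cast P.2.1 x
  trace_eq_one := by
    have h : ∑ x, P x = 1 := P.2.2
    simp only [map_sum, map_smul, (W _).trace_eq_one, smul_eq_mul, mul_one]
    exact_mod_cast h

/-- Mutual information `I(P;W) = H(PW) - ∑ₓ P(x) H(Wₓ)` of a cq-channel. -/
def mutualInfo {X : Type*} [Fintype X] (P : Dist X) (W : CQChannel H X) : ℝ :=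
  vonNeumannEntropy (averageState P W) - ∑ x, P x * vonNeumannEntropy (W x)

/-- The trace of a product of two positive operators has nonnegative real part. -/
theorem trace_mul_re_nonneg {A B : H →ₗ[ℂ] H} (hA : A.IsPositive) (hB : B.IsPositive) :
    0 ≤ (LinearMap.trace ℂ H (A * B)).re := by
  rw [LinearMap.trace_mul_comm,
    LinearMap.trace_eq_sum_inner _ (hA.isSymmetric.eigenvectorBasis rfl), Complex.re_sum]
  refine Finset.sum_nonneg fun i _ => ?_
  rw [Module.End.mul_apply, LinearMap.IsSymmetric.apply_eigenvectorBasis, map_smul,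
    inner_smul_right]
  have h1 := hA.nonneg_eigenvalues rfl i
  have h2 := hB.re_inner_nonneg_right (hA.isSymmetric.eigenvectorBasis rfl i)
  have h3 := mul_nonneg h1 h2
  simpa using h3

/-- The classical channel `D∘W : X → Y`, which sends `x` to the outcome distribution
`y ↦ Tr(Wₓ D_y)` of the measurement of `D` in the state `Wₓ` (these traces are real). -/
def measure {X Y : Type*} [Fintype Y] (D : Observable H Y) (W : CQChannel H X) :
    ClassicalChannel X Y :=
  fun x => ⟨fun y => (LinearMap.trace ℂ H ((W x).op * D.op y)).re, by
    refine ⟨fun y => trace_mul_re_nonneg (W x).pos (D.pos y), ?_⟩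
    rw [← Complex.re_sum, ← map_sum, ← Finset.mul_sum, D.sum_eq_one, mul_one,
      (W x).trace_eq_one, Complex.one_re]⟩

/-- The values `I(P;W)` over all input distributions `P`. -/
def infoValues {X : Type*} [Fintype X] (W : CQChannel H X) : Set ℝ :=
  {r | ∃ P : Dist X, r = mutualInfo P W}

/-- The values `I(P;D∘W)` over all input distributions `P` and all observables `D` with finitely
many outcomes (every finite index set is in bijection with some `Fin k`). -/
def measuredInfoValues {X : Type*} [Fintype X] (W : CQChannel H X) : Set ℝ :=
  {r | ∃ (k : ℕ) (P : Dist X) (D : Observable H (Fin k)), r = classicalMutualInfo P (measure D W)}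

/-- `C(W) = max_P I(P;W)`. -/
def capacity {X : Type*} [Fintype X] (W : CQChannel H X) : ℝ := sSup (infoValues W)

/-- `C₁ = max_{P,D} I(P;D∘W)`. -/
def capacityOne {X : Type*} [Fintype X] (W : CQChannel H X) : ℝ := sSup (measuredInfoValues W)

end Quantum

end CQ

end

open Filter Topology

namespace CQ

/-! Writing `S(ρ‖σ)` for the relative entropy and `σ = ∑ₓ P(x) Wₓ`, one has `I(P;W) = ∑ₓ P(x)
S(Wₓ‖σ)`, and likewise for `D∘W`. The bound thus reduces to monotonicity of relative entropy under a
measurement (`measured_relativeEntropy_le`).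

With eigenpairs `(rᵢ, eᵢ)` of `ρ` and `(sⱼ, fⱼ)` of `σ`, `S(ρ‖σ)` is the classical relative entropy
of the arrays `|⟨eᵢ,fⱼ⟩|² rᵢ` and `|⟨eᵢ,fⱼ⟩|² sⱼ`. By `sum_mul_log_sub_log_le_of_resolvent`, it
suffices to compare the sums `∑ a²/(b + ua)`. The quantum sum is bounded below by `2 Tr ρZ - Tr σZ²
- u Tr ρZ²` for every symmetric `Z`. Taking `Z = ∑ z_y D_y` with the classically optimal `z`, and
using `Z² ≤ ∑ z_y² D_y`, yields the measured sum.

`C(W)` is attained because `I(·;W)` is upper semicontinuous on a compact simplex. For `C₁`,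
Carathéodory's theorem bounds the number of outcomes, after which a continuous function is maximised
on a compact set. -/

/-! ### From resolvent sums to relative entropies -/

/-- If the masses agree, an inequality between the resolvent sums `∑ a² / (b + u a)` for all `u > 0`
integrates to the same inequality between relative entropies. -/
theorem sum_mul_log_sub_log_le_of_resolvent {ι κ : Type*} [Fintype ι] [Fintype κ]
    {a b : ι → ℝ} {c d : κ → ℝ}
    (ha : ∀ i, 0 ≤ a i) (hb : ∀ i, 0 ≤ b i) (hab : ∀ i, b i = 0 → a i = 0)
    (hc : ∀ i, 0 ≤ c i) (hd : ∀ i, 0 ≤ d i) (hcd : ∀ i, d i = 0 → c i = 0)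
    (hmass : ∑ i, c i = ∑ i, a i)
    (h : ∀ u : ℝ, 0 < u →
      ∑ i, c i ^ 2 / (d i + u * c i) ≤ ∑ i, a i ^ 2 / (b i + u * a i)) :
    ∑ i, c i * (Real.log (c i) - Real.log (d i)) ≤
      ∑ i, a i * (Real.log (a i) - Real.log (b i)) := by
  have hderiv : ∀ (x y u : ℝ), 0 ≤ x → 0 ≤ y → (y = 0 → x = 0) → 0 ≤ u →
      HasDerivAt (fun u => x * Real.log (y + u * x)) (x ^ 2 / (y + u * x)) u := by
    intro x y u hx hy hyx hu
    rcases hx.eq_or_lt with rfl | hx'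
    · simpa using hasDerivAt_const u (0 : ℝ)
    · have hy' : 0 < y := lt_of_le_of_ne hy fun h => hx'.ne' (hyx h.symm)
      have hpos : y + u * x ≠ 0 := by positivity
      have h1 : HasDerivAt (fun u => y + u * x) x u := by
        simpa using ((hasDerivAt_id u).mul_const x).const_add y
      exact ((h1.log hpos).const_mul x).congr_deriv (by rw [sq, mul_div_assoc])
  set G : ℝ → ℝ := fun u =>
    ∑ i, a i * Real.log (b i + u * a i) - ∑ i, c i * Real.log (d i + u * c i) with hG
  have hGd : ∀ u, 0 ≤ u → HasDerivAt G
      (∑ i, a i ^ 2 / (b i + u * a i) - ∑ i, c i ^ 2 / (d i + u * c i)) u := fun u hu =>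
    (HasDerivAt.fun_sum fun i _ => hderiv _ _ _ (ha i) (hb i) (hab i) hu).sub
      (HasDerivAt.fun_sum fun i _ => hderiv _ _ _ (hc i) (hd i) (hcd i) hu)
  have hmono : MonotoneOn G (Set.Ici 0) := by
    refine monotoneOn_of_deriv_nonneg (convex_Ici 0)
      (fun u hu => (hGd u hu).continuousAt.continuousWithinAt) ?_ ?_
    · intro u hu
      rw [interior_Ici] at hu
      exact (hGd u (le_of_lt hu)).differentiableAt.differentiableWithinAt
    · intro u hu
      rw [interior_Ici] at hu
      rw [(hGd u (le_of_lt hu)).deriv]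
      exact sub_nonneg.2 (h u hu)
  -- The substitution `v = 1/u` moves `u → ∞` to `v → 0`. The divergent `log v` terms cancel in `G`
  -- because the masses agree.
  have hscale : ∀ (x y v : ℝ), 0 ≤ x → 0 ≤ y → 0 < v →
      x * Real.log (y + v⁻¹ * x) = x * Real.log (v * y + x) - x * Real.log v := by
    intro x y v hx hy hv
    rcases hx.eq_or_lt with rfl | hx'
    · simp
    · rw [show y + v⁻¹ * x = (v * y + x) / v by field_simp,
        Real.log_div (by positivity) hv.ne']
      ring
  set K : ℝ → ℝ := fun v =>
    ∑ i, a i * Real.log (v * b i + a i) - ∑ i, c i * Real.log (v * d i + c i) with hK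
  have hGK : ∀ v, 0 < v → G v⁻¹ = K v := by
    intro v hv
    simp only [hG, hK]
    rw [Finset.sum_congr rfl fun i _ => hscale _ _ v (ha i) (hb i) hv,
      Finset.sum_congr rfl fun i _ => hscale _ _ v (hc i) (hd i) hv,
      Finset.sum_sub_distrib, Finset.sum_sub_distrib, ← Finset.sum_mul, ← Finset.sum_mul, hmass]
    ring
  have hcont : ∀ (x y : ℝ), ContinuousAt (fun v => x * Real.log (v * y + x)) 0 := by
    intro x y
    by_cases hx : x = 0
    · subst hx; simpa using continuousAt_const
    · exact continuousAt_const.mul (ContinuousAt.log (by fun_prop) (by simpa using hx))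
  have hKc : ContinuousAt K 0 :=
    (tendsto_finsetSum _ fun i _ => hcont (a i) (b i)).sub
      (tendsto_finsetSum _ fun i _ => hcont (c i) (d i))
  -- `K 0` is the limit of the monotone `G` at infinity; `G 0 ≤ K 0` is the claim rearranged.
  have hle : G 0 ≤ K 0 := by
    refine ge_of_tendsto (hKc.tendsto.mono_left (nhdsWithin_le_nhds (s := Set.Ioi 0))) ?_
    filter_upwards [self_mem_nhdsWithin] with v hv
    rw [← hGK v hv]
    exact hmono (Set.mem_Ici.2 le_rfl) (Set.mem_Ici.2 (inv_nonneg.2 (le_of_lt hv)))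
      (inv_nonneg.2 (le_of_lt hv))
  simp only [hG, hK, zero_mul, add_zero, zero_add] at hle
  simp only [mul_sub, Finset.sum_sub_distrib]
  linarith

/-! ### Measurements do not increase relative entropy -/

section Operators

variable {H : Type*} [NormedAddCommGroup H] [InnerProductSpace ℂ H]

/-- A Kadison-Schwarz inequality for the operator `∑ z_y D_y`. -/
theorem norm_sq_sum_smul_apply_le {Y : Type*} [Fintype Y] (D : Observable H Y) (z : Y → ℝ)
    (v : H) :
    ‖(∑ y, (z y : ℂ) • D.op y) v‖ ^ 2 ≤ ∑ y, z y ^ 2 * (inner ℂ v (D.op y v)).re := by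
  set Z : H →ₗ[ℂ] H := ∑ y, (z y : ℂ) • D.op y with hZ
  -- Variance argument: summed over `y`, these terms give `∑ z_y² ⟨v, D_y v⟩ - ‖Zv‖²`, since `∑ D_y
  -- = 1`.
  have hpos : ∀ y, 0 ≤ (inner ℂ ((z y : ℂ) • v - Z v) (D.op y ((z y : ℂ) • v - Z v))).re :=
    fun y => (D.pos y).re_inner_nonneg_right _
  have hexp : ∀ y, (inner ℂ ((z y : ℂ) • v - Z v) (D.op y ((z y : ℂ) • v - Z v))).re =
      z y ^ 2 * (inner ℂ v (D.op y v)).re - 2 * (inner ℂ (Z v) ((z y : ℂ) • D.op y v)).re +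
        (inner ℂ (Z v) (D.op y (Z v))).re := by
    intro y
    have hsym : (inner ℂ v (D.op y (Z v))).re = (inner ℂ (Z v) (D.op y v)).re := by
      rw [← (D.pos y).isSymmetric v (Z v), ← inner_conj_symm, Complex.conj_re]
    simp only [map_sub, map_smul, inner_sub_left, inner_sub_right, inner_smul_left,
      inner_smul_right, Complex.conj_ofReal, Complex.sub_re, Complex.re_ofReal_mul]
    rw [hsym]
    ring
  have h1 : ∑ y, (inner ℂ (Z v) ((z y : ℂ) • D.op y v)).re = ‖Z v‖ ^ 2 := by
    rw [← Complex.re_sum, ← inner_sum]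
    have : ∑ y, (z y : ℂ) • D.op y v = Z v := by simp [hZ, LinearMap.sum_apply]
    rw [this, inner_self_eq_norm_sq_to_K]
    norm_cast
  have h2 : ∑ y, (inner ℂ (Z v) (D.op y (Z v))).re = ‖Z v‖ ^ 2 := by
    rw [← Complex.re_sum, ← inner_sum]
    have : ∑ y, D.op y (Z v) = Z v := by
      rw [← LinearMap.sum_apply, D.sum_eq_one, Module.End.one_apply]
    rw [this, inner_self_eq_norm_sq_to_K]
    norm_cast
  have h3 := Finset.sum_nonneg fun y (_ : y ∈ Finset.univ) => hpos y
  rw [Finset.sum_congr rfl fun y _ => hexp y, Finset.sum_add_distrib, Finset.sum_sub_distrib,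
    ← Finset.mul_sum, h1, h2] at h3
  linarith

variable [FiniteDimensional ℂ H]

/-- The trace of a product with a symmetric operator, computed in an eigenbasis. -/
theorem trace_mul_re_eq_sum_eigenvalues {A : H →ₗ[ℂ] H} (hA : A.IsSymmetric) (B : H →ₗ[ℂ] H)
    {n : ℕ} (hn : Module.finrank ℂ H = n) :
    (LinearMap.trace ℂ H (A * B)).re = ∑ i, hA.eigenvalues hn i *
      (inner ℂ (hA.eigenvectorBasis hn i) (B (hA.eigenvectorBasis hn i))).re := by
  rw [LinearMap.trace_mul_comm, LinearMap.trace_eq_sum_inner _ (hA.eigenvectorBasis hn),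
    Complex.re_sum]
  refine Finset.sum_congr rfl fun i _ => ?_
  rw [Module.End.mul_apply, LinearMap.IsSymmetric.apply_eigenvectorBasis, map_smul,
    inner_smul_right]
  simp

/-- Completing the square in `‖z‖`; this is the entrywise form of the variational bound below. -/
theorem two_mul_re_sub_le {r s u : ℝ} (hr : 0 ≤ r) (hs : 0 ≤ s) (hu : 0 < u) (c z : ℂ) :
    2 * (r * (c * z).re) - s * ‖z‖ ^ 2 - u * (r * ‖z‖ ^ 2) ≤
      ‖c‖ ^ 2 * r ^ 2 / (s + u * r) := by
  rcases hr.eq_or_lt with rfl | hr'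
  · simp; positivity
  · have hm : 0 < s + u * r := by positivity
    rw [le_div_iff₀ hm]
    have h1 : (c * z).re ≤ ‖c‖ * ‖z‖ := by
      rw [← norm_mul]; exact Complex.re_le_norm _
    have h2 : 2 * (r * (c * z).re) ≤ 2 * (r * (‖c‖ * ‖z‖)) := by gcongr
    have h3 := mul_le_mul_of_nonneg_right h2 hm.le
    nlinarith [sq_nonneg (‖c‖ * r - (s + u * r) * ‖z‖)]

/-- Variational lower bound for the resolvent sum of two positive operators, written in their
eigenbases. -/
theorem two_mul_trace_sub_le_resolvent {ρ σ Z : H →ₗ[ℂ] H} (hρ : ρ.IsPositive)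
    (hσ : σ.IsPositive) (hZ : Z.IsSymmetric) {n : ℕ} (hn : Module.finrank ℂ H = n)
    {u : ℝ} (hu : 0 < u) :
    2 * (LinearMap.trace ℂ H (ρ * Z)).re - (LinearMap.trace ℂ H (σ * (Z * Z))).re
        - u * (LinearMap.trace ℂ H (ρ * (Z * Z))).re ≤
      ∑ ij : Fin n × Fin n,
        ‖inner ℂ (hρ.isSymmetric.eigenvectorBasis hn ij.1)
          (hσ.isSymmetric.eigenvectorBasis hn ij.2)‖ ^ 2 *
        hρ.isSymmetric.eigenvalues hn ij.1 ^ 2 /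
          (hσ.isSymmetric.eigenvalues hn ij.2 + u * hρ.isSymmetric.eigenvalues hn ij.1) := by
  set e := hρ.isSymmetric.eigenvectorBasis hn
  set f := hσ.isSymmetric.eigenvectorBasis hn
  set r := hρ.isSymmetric.eigenvalues hn
  set s := hσ.isSymmetric.eigenvalues hn
  have hsq : ∀ (g : OrthonormalBasis (Fin n) ℂ H) (v : H),
      (inner ℂ v ((Z * Z) v)).re = ∑ j, ‖inner ℂ (g j) (Z v)‖ ^ 2 := by
    intro g v
    rw [Module.End.mul_apply, ← hZ, inner_self_eq_norm_sq_to_K, g.sum_sq_norm_inner_right]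
    norm_cast
  have h1 : (LinearMap.trace ℂ H (ρ * Z)).re =
      ∑ i, ∑ j, r i * (inner ℂ (e i) (f j) * inner ℂ (f j) (Z (e i))).re := by
    rw [trace_mul_re_eq_sum_eigenvalues hρ.isSymmetric Z hn]
    refine Finset.sum_congr rfl fun i _ => ?_
    rw [← Finset.mul_sum, ← Complex.re_sum, f.sum_inner_mul_inner]
  have h2 : (LinearMap.trace ℂ H (ρ * (Z * Z))).re =
      ∑ i, ∑ j, r i * ‖inner ℂ (f j) (Z (e i))‖ ^ 2 := by
    rw [trace_mul_re_eq_sum_eigenvalues hρ.isSymmetric (Z * Z) hn]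
    refine Finset.sum_congr rfl fun i _ => ?_
    rw [← Finset.mul_sum, ← hsq f]
  -- Symmetry of `Z` lets the trace against `σ` use the same numbers `|⟨fⱼ, Z eᵢ⟩|²` as the trace
  -- against `ρ`.
  have h3 : (LinearMap.trace ℂ H (σ * (Z * Z))).re =
      ∑ i, ∑ j, s j * ‖inner ℂ (f j) (Z (e i))‖ ^ 2 := by
    rw [trace_mul_re_eq_sum_eigenvalues hσ.isSymmetric (Z * Z) hn, Finset.sum_comm]
    refine Finset.sum_congr rfl fun j _ => ?_
    rw [← Finset.mul_sum, hsq e]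
    congr 1
    refine Finset.sum_congr rfl fun i _ => ?_
    rw [← hZ, norm_inner_symm]
  rw [h1, h2, h3, Fintype.sum_prod_type]
  simp only [Finset.mul_sum, ← Finset.sum_sub_distrib]
  exact Finset.sum_le_sum fun i _ => Finset.sum_le_sum fun j _ =>
    two_mul_re_sub_le (hρ.nonneg_eigenvalues hn i) (hσ.nonneg_eigenvalues hn j) hu _ _

/-- The diagonal of a symmetric operator in terms of its eigenvalues. -/
theorem re_inner_apply_self_eq_sum_eigenvalues {A : H →ₗ[ℂ] H} (hA : A.IsSymmetric) {n : ℕ}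
    (hn : Module.finrank ℂ H = n) (v : H) :
    (inner ℂ v (A v)).re = ∑ i, ‖inner ℂ (hA.eigenvectorBasis hn i) v‖ ^ 2 *
      hA.eigenvalues hn i := by
  rw [← (hA.eigenvectorBasis hn).sum_inner_mul_inner v (A v), Complex.re_sum]
  refine Finset.sum_congr rfl fun i _ => ?_
  rw [← hA, LinearMap.IsSymmetric.apply_eigenvectorBasis, inner_smul_left,
    ← inner_conj_symm v]
  have h : (starRingEnd ℂ) (inner ℂ (hA.eigenvectorBasis hn i) v) *
      inner ℂ (hA.eigenvectorBasis hn i) v =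
      ((‖inner ℂ (hA.eigenvectorBasis hn i) v‖ ^ 2 : ℝ) : ℂ) := by
    rw [← Complex.normSq_eq_conj_mul_self, Complex.normSq_eq_norm_sq]
  rw [mul_left_comm, h]
  simp [mul_comm]
  exact Or.inl (by norm_cast)

/-- Both traces are evaluated in an eigenbasis of `C`. This carries domination of states over to
outcome probabilities. -/
theorem trace_mul_re_mono {A B C : H →ₗ[ℂ] H} {c : ℝ} (hC : C.IsPositive)
    (h : ∀ v, c * (inner ℂ v (A v)).re ≤ (inner ℂ v (B v)).re) :
    c * (LinearMap.trace ℂ H (A * C)).re ≤ (LinearMap.trace ℂ H (B * C)).re := by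
  rw [LinearMap.trace_mul_comm, LinearMap.trace_mul_comm ℂ B,
    trace_mul_re_eq_sum_eigenvalues hC.isSymmetric A rfl,
    trace_mul_re_eq_sum_eigenvalues hC.isSymmetric B rfl, Finset.mul_sum]
  refine Finset.sum_le_sum fun i _ => ?_
  rw [mul_left_comm]
  exact mul_le_mul_of_nonneg_left (h _) (hC.nonneg_eigenvalues rfl i)

/-- A measurement does not increase the relative entropy of two states; the relative entropy of
the states is written in their eigenbases. -/
theorem measured_relativeEntropy_le {Y : Type*} [Fintype Y] (ρ σ : State H) (D : Observable H Y)
    {c : ℝ} (hc : 0 < c) (hdom : ∀ v, c * (inner ℂ v (ρ.op v)).re ≤ (inner ℂ v (σ.op v)).re)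
    {n : ℕ} (hn : Module.finrank ℂ H = n) :
    ∑ y, (LinearMap.trace ℂ H (ρ.op * D.op y)).re *
        (Real.log (LinearMap.trace ℂ H (ρ.op * D.op y)).re -
          Real.log (LinearMap.trace ℂ H (σ.op * D.op y)).re) ≤
      ∑ i, ρ.pos.isSymmetric.eigenvalues hn i * Real.log (ρ.pos.isSymmetric.eigenvalues hn i) -
      ∑ j, (inner ℂ (σ.pos.isSymmetric.eigenvectorBasis hn j)
          (ρ.op (σ.pos.isSymmetric.eigenvectorBasis hn j))).re *
        Real.log (σ.pos.isSymmetric.eigenvalues hn j) := by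
  set e := ρ.pos.isSymmetric.eigenvectorBasis hn with he
  set f := σ.pos.isSymmetric.eigenvectorBasis hn with hf
  set r := ρ.pos.isSymmetric.eigenvalues hn with hr
  set s := σ.pos.isSymmetric.eigenvalues hn with hs
  set p : Y → ℝ := fun y => (LinearMap.trace ℂ H (ρ.op * D.op y)).re with hp
  set q : Y → ℝ := fun y => (LinearMap.trace ℂ H (σ.op * D.op y)).re with hq
  set w : Fin n × Fin n → ℝ := fun ij => ‖inner ℂ (e ij.1) (f ij.2)‖ ^ 2 with hw
  have hr0 : ∀ i, 0 ≤ r i := ρ.pos.nonneg_eigenvalues hn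
  have hs0 : ∀ i, 0 ≤ s i := σ.pos.nonneg_eigenvalues hn
  have hw0 : ∀ ij, 0 ≤ w ij := fun ij => by positivity
  have hp0 : ∀ y, 0 ≤ p y := fun y => trace_mul_re_nonneg ρ.pos (D.pos y)
  have hq0 : ∀ y, 0 ≤ q y := fun y => trace_mul_re_nonneg σ.pos (D.pos y)
  have hwsum : ∀ i, ∑ j, w (i, j) = 1 := fun i => by
    simp only [hw]
    rw [f.sum_sq_norm_inner_left, e.orthonormal.1 i, one_pow]
  have hdiag : ∀ j, (inner ℂ (f j) (ρ.op (f j))).re = ∑ i, w (i, j) * r i := fun j =>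
    re_inner_apply_self_eq_sum_eigenvalues ρ.pos.isSymmetric hn (f j)
  have hpq : ∀ y, q y = 0 → p y = 0 := fun y hy => by
    have h1 : c * p y ≤ q y := trace_mul_re_mono (D.pos y) hdom
    rw [hy] at h1
    exact le_antisymm (by nlinarith) (hp0 y)
  -- Domination forces `⟨fⱼ, ρ fⱼ⟩ = 0` when `sⱼ = 0`, and this is a sum of nonnegative terms.
  have hsupp : ∀ i j, s j = 0 → w (i, j) * r i = 0 := fun i j hj => by
    have h1 := hdom (f j)
    have h2 : (inner ℂ (f j) (σ.op (f j))).re = 0 := by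
      rw [hf, LinearMap.IsSymmetric.apply_eigenvectorBasis, ← hs, hj]
      simp
    have h3 : ∑ i, w (i, j) * r i = 0 := by
      rw [← hdiag]
      refine le_antisymm ?_ (ρ.pos.re_inner_nonneg_right _)
      rw [h2] at h1
      by_contra hcon
      exact absurd h1 (not_le.2 (mul_pos hc (not_le.1 hcon)))
    exact (Finset.sum_eq_zero_iff_of_nonneg fun i _ => mul_nonneg (hw0 _) (hr0 _)).1 h3 i
      (Finset.mem_univ i)
  have hrsum : ∑ i, r i = 1 := by
    have h1 := trace_mul_re_eq_sum_eigenvalues ρ.pos.isSymmetric 1 hn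
    rw [mul_one, ρ.trace_eq_one] at h1
    simpa using h1.symm
  have hpsum : ∑ y, p y = 1 := by
    simp only [hp]
    rw [← Complex.re_sum, ← map_sum, ← Finset.mul_sum, D.sum_eq_one, mul_one, ρ.trace_eq_one,
      Complex.one_re]
  have hmass : ∑ ij, w ij * r ij.1 = 1 := by
    rw [Fintype.sum_prod_type]
    simp only [← Finset.sum_mul, hwsum, one_mul, hrsum]
  have hres : ∀ u : ℝ, 0 < u → ∑ y, p y ^ 2 / (q y + u * p y) ≤
      ∑ ij, (w ij * r ij.1) ^ 2 / (w ij * s ij.2 + u * (w ij * r ij.1)) := by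
    intro u hu
    -- The maximiser of `2 z p - z² (q + u p)`, with maximum `p² / (q + u p)`; if the denominator
    -- vanishes, division by zero makes both sides `0`.
    set z : Y → ℝ := fun y => p y / (q y + u * p y) with hz
    set Z : H →ₗ[ℂ] H := ∑ y, (z y : ℂ) • D.op y with hZ
    have hZs : Z.IsSymmetric := by
      intro v v'
      simp only [hZ, LinearMap.sum_apply, LinearMap.smul_apply, sum_inner, inner_sum,
        inner_smul_left, inner_smul_right, Complex.conj_ofReal, (D.pos _).isSymmetric _ _]
    have h1 := two_mul_trace_sub_le_resolvent ρ.pos σ.pos hZs hn hu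
    have h2 : (LinearMap.trace ℂ H (ρ.op * Z)).re = ∑ y, z y * p y := by
      simp only [hZ, Finset.mul_sum, mul_smul_comm, map_sum, map_smul, Complex.re_sum, smul_eq_mul,
        Complex.re_ofReal_mul, hp]
    have hkad : ∀ τ : State H, (LinearMap.trace ℂ H (τ.op * (Z * Z))).re ≤
        ∑ y, z y ^ 2 * (LinearMap.trace ℂ H (τ.op * D.op y)).re := by
      intro τ
      simp only [trace_mul_re_eq_sum_eigenvalues τ.pos.isSymmetric _ hn, Finset.mul_sum]
      rw [Finset.sum_comm]
      refine Finset.sum_le_sum fun i _ => ?_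
      simp only [mul_left_comm, ← Finset.mul_sum]
      refine mul_le_mul_of_nonneg_left ?_ (τ.pos.nonneg_eigenvalues hn i)
      refine le_trans (le_of_eq ?_) (norm_sq_sum_smul_apply_le D z _)
      rw [Module.End.mul_apply, ← hZs, inner_self_eq_norm_sq_to_K]
      norm_cast
    have h3 := hkad σ
    have h4 := mul_le_mul_of_nonneg_left (hkad ρ) hu.le
    have h5 : ∑ y, p y ^ 2 / (q y + u * p y) =
        2 * ∑ y, z y * p y - ∑ y, z y ^ 2 * q y - u * ∑ y, z y ^ 2 * p y := by
      simp only [Finset.mul_sum, ← Finset.sum_sub_distrib]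
      refine Finset.sum_congr rfl fun y _ => ?_
      simp only [hz]
      by_cases hm : q y + u * p y = 0
      · simp [hm]
      · obtain ⟨m, hm'⟩ : ∃ m, m = q y + u * p y := ⟨_, rfl⟩
        rw [← hm'] at hm ⊢
        rw [eq_sub_of_add_eq hm'.symm]
        field_simp
        ring
    have h6 : ∀ ij, (w ij * r ij.1) ^ 2 / (w ij * s ij.2 + u * (w ij * r ij.1)) =
        w ij * r ij.1 ^ 2 / (s ij.2 + u * r ij.1) := by
      intro ij
      by_cases hwz : w ij = 0
      · simp [hwz]
      · rw [show (w ij * r ij.1) ^ 2 = w ij * (w ij * r ij.1 ^ 2) by ring,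
          show w ij * s ij.2 + u * (w ij * r ij.1) = w ij * (s ij.2 + u * r ij.1) by ring,
          mul_div_mul_left _ _ hwz]
    rw [h5, Finset.sum_congr rfl fun ij _ => h6 ij]
    rw [h2] at h1
    linarith
  have hmain := sum_mul_log_sub_log_le_of_resolvent (a := fun ij => w ij * r ij.1)
    (b := fun ij => w ij * s ij.2) (fun ij => mul_nonneg (hw0 _) (hr0 _))
    (fun ij => mul_nonneg (hw0 _) (hs0 _))
    (fun ij h => (mul_eq_zero.1 h).elim (fun h => by simp [h]) (hsupp ij.1 ij.2))
    hp0 hq0 hpq (hpsum.trans hmass.symm) hres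
  refine hmain.trans (le_of_eq ?_)
  -- The common factor `w` cancels inside the logarithms, leaving the quantum relative entropy.
  have hlog : ∀ ij : Fin n × Fin n,
      w ij * r ij.1 * (Real.log (w ij * r ij.1) - Real.log (w ij * s ij.2)) =
        w ij * (r ij.1 * Real.log (r ij.1)) - w ij * r ij.1 * Real.log (s ij.2) := by
    intro ij
    by_cases h0 : w ij * r ij.1 = 0
    · rw [← mul_assoc, h0]; simp
    · obtain ⟨hw', hr'⟩ := mul_ne_zero_iff.1 h0
      have hs' : s ij.2 ≠ 0 := fun h => h0 (hsupp ij.1 ij.2 h)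
      rw [Real.log_mul hw' hr', Real.log_mul hw' hs']
      ring
  rw [Finset.sum_congr rfl fun ij _ => hlog ij, Finset.sum_sub_distrib]
  congr 1
  · rw [Fintype.sum_prod_type]
    simp only [← Finset.sum_mul, hwsum, one_mul]
  · rw [Fintype.sum_prod_type_right]
    refine Finset.sum_congr rfl fun j _ => ?_
    rw [hdiag, Finset.sum_mul]

/-! ### The Holevo bound -/

theorem entropySum_eq_neg_div {Y : Type*} [Fintype Y] (p : Y → ℝ) :
    entropySum p = -(∑ y, p y * Real.log (p y)) / Real.log 2 := by
  simp only [entropySum, Real.logb, mul_div_assoc', ← Finset.sum_div, neg_div]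

theorem outputDist_measure_apply {X Y : Type*} [Fintype X] [Fintype Y] (P : Dist X)
    (W : CQChannel H X) (D : Observable H Y) (y : Y) :
    outputDist P (measure D W) y =
      (LinearMap.trace ℂ H ((averageState P W).op * D.op y)).re := by
  change ∑ x, P x * (LinearMap.trace ℂ H ((W x).op * D.op y)).re = _
  simp only [averageState, Finset.sum_mul, smul_mul_assoc, map_sum, map_smul, Complex.re_sum,
    smul_eq_mul, Complex.re_ofReal_mul]

/-- **Holevo bound.** -/
theorem classicalMutualInfo_measure_le {X Y : Type*} [Fintype X] [Fintype Y]
    (W : CQChannel H X) (P : Dist X) (D : Observable H Y) :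
    classicalMutualInfo P (measure D W) ≤ mutualInfo P W := by
  set σ := averageState P W with hσ
  set q : Y → ℝ := fun y => (LinearMap.trace ℂ H (σ.op * D.op y)).re with hq
  set p : X → Y → ℝ := fun x y => (LinearMap.trace ℂ H ((W x).op * D.op y)).re with hp
  set s := σ.pos.isSymmetric.eigenvalues rfl with hs
  set f := σ.pos.isSymmetric.eigenvectorBasis rfl with hf
  have hPσ : ∀ v : H, (inner ℂ v (σ.op v)).re = ∑ x, P x * (inner ℂ v ((W x).op v)).re := by
    intro v
    simp only [hσ, averageState, LinearMap.sum_apply, LinearMap.smul_apply, inner_sum,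
      inner_smul_right, Complex.re_sum, Complex.re_ofReal_mul]
  have hstep : ∀ x, P x * ∑ y, p x y * (Real.log (p x y) - Real.log (q y)) ≤
      P x * (∑ i, (W x).pos.isSymmetric.eigenvalues rfl i *
          Real.log ((W x).pos.isSymmetric.eigenvalues rfl i) -
        ∑ j, (inner ℂ (f j) ((W x).op (f j))).re * Real.log (s j)) := by
    intro x
    rcases (P.2.1 x).eq_or_lt with h0 | hpos
    · have h0' : P x = 0 := h0.symm
      simp [h0']
    -- The domination constant is `P x`, since `P(x) Wₓ ≤ σ`.
    · refine mul_le_mul_of_nonneg_left (measured_relativeEntropy_le (W x) σ D hpos ?_ rfl) hpos.le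
      intro v
      rw [hPσ]
      exact Finset.single_le_sum (f := fun x => P x * (inner ℂ v ((W x).op v)).re)
        (fun x _ => mul_nonneg (P.2.1 x) ((W x).pos.re_inner_nonneg_right v)) (Finset.mem_univ x)
  have hsum := Finset.sum_le_sum fun x (_ : x ∈ Finset.univ) => hstep x
  have hqsum : ∀ y, q y = ∑ x, P x * p x y := fun y => (outputDist_measure_apply P W D y).symm
  have hssum : ∀ j, s j = ∑ x, P x * (inner ℂ (f j) ((W x).op (f j))).re := by
    intro j
    rw [← hPσ, hf, LinearMap.IsSymmetric.apply_eigenvectorBasis, inner_smul_right,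
      inner_self_eq_norm_sq_to_K]
    simp [hs]
  have h1 : ∑ x, P x * ∑ y, p x y * (Real.log (p x y) - Real.log (q y)) =
      ∑ x, P x * ∑ y, p x y * Real.log (p x y) - ∑ y, q y * Real.log (q y) := by
    simp only [mul_sub, Finset.sum_sub_distrib]
    congr 1
    simp only [Finset.mul_sum]
    rw [Finset.sum_comm]
    refine Finset.sum_congr rfl fun y _ => ?_
    conv_rhs => rw [hqsum y, Finset.sum_mul, ← hqsum y]
    exact Finset.sum_congr rfl fun x _ => (mul_assoc _ _ _).symm
  have h2 : ∑ x, P x * ∑ j, (inner ℂ (f j) ((W x).op (f j))).re * Real.log (s j) =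
      ∑ j, s j * Real.log (s j) := by
    simp only [Finset.mul_sum]
    rw [Finset.sum_comm]
    refine Finset.sum_congr rfl fun j _ => ?_
    conv_rhs => rw [hssum j, Finset.sum_mul, ← hssum j]
    exact Finset.sum_congr rfl fun x _ => (mul_assoc _ _ _).symm
  simp only [mul_sub (P _) (∑ i, _) (∑ j, _), Finset.sum_sub_distrib] at hsum
  rw [h2] at hsum
  have hcl : classicalMutualInfo P (measure D W) =
      (∑ x, P x * ∑ y, p x y * Real.log (p x y) - ∑ y, q y * Real.log (q y)) / Real.log 2 := by
    have ho : shannonEntropy (outputDist P (measure D W)) = entropySum q :=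
      congrArg entropySum (funext fun y => outputDist_measure_apply P W D y)
    have hx : ∀ x, shannonEntropy (measure D W x) = entropySum (p x) := fun x => rfl
    simp only [classicalMutualInfo, ho, hx, entropySum_eq_neg_div, mul_div_assoc', mul_neg,
      ← Finset.sum_div, Finset.sum_neg_distrib]
    ring
  have hqu : mutualInfo P W =
      (∑ x, P x * ∑ i, (W x).pos.isSymmetric.eigenvalues rfl i *
          Real.log ((W x).pos.isSymmetric.eigenvalues rfl i) -
        ∑ j, s j * Real.log (s j)) / Real.log 2 := by
    simp only [mutualInfo, vonNeumannEntropy, entropySum_eq_neg_div, mul_div_assoc', mul_neg,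
      ← Finset.sum_div, Finset.sum_neg_distrib]
    ring
  rw [hcl, hqu]
  refine div_le_div_of_nonneg_right ?_ (Real.log_nonneg one_le_two)
  simp only [mul_sub, Finset.sum_sub_distrib] at h1 hsum
  linarith

end Operators

/-! ### Continuity and homogeneity of the information -/

theorem entropySum_eq_sum_negMulLog {Y : Type*} [Fintype Y] (p : Y → ℝ) :
    entropySum p = (∑ y, Real.negMulLog (p y)) / Real.log 2 := by
  simp only [entropySum_eq_neg_div, Real.negMulLog, neg_mul, Finset.sum_neg_distrib]

theorem continuous_entropySum {Y : Type*} [Fintype Y] :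
    Continuous (entropySum : (Y → ℝ) → ℝ) := by
  simp only [funext entropySum_eq_sum_negMulLog]
  exact (continuous_finsetSum _ fun y _ =>
    Real.continuous_negMulLog.comp (continuous_apply y)).div_const _

theorem Dist.continuous_apply {X : Type*} [Fintype X] (x : X) :
    Continuous fun P : Dist X => P x :=
  (_root_.continuous_apply x).comp continuous_subtype_val

section Operators

variable {H : Type*} [NormedAddCommGroup H] [InnerProductSpace ℂ H]

/-- A bound, depending only on the Hilbert space, for the number of outcomes of observables that
suffice to realise all values of a positively homogeneous outcome function. -/
noncomputable def outcomeBound (H : Type*) [NormedAddCommGroup H] [InnerProductSpace ℂ H] : ℕ :=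
  Module.finrank ℝ ((H →ₗ[ℂ] H) × ℝ) + 1

/-- The contribution (in nats) of an outcome with operator `E` to the measured information. -/
noncomputable def outcomeInfo {X : Type*} [Fintype X] (P : Dist X) (W : CQChannel H X) (E : H →ₗ[ℂ] H) : ℝ :=
  Real.negMulLog (∑ x, P x * (LinearMap.trace ℂ H ((W x).op * E)).re) -
    ∑ x, P x * Real.negMulLog (LinearMap.trace ℂ H ((W x).op * E)).re

/-- The product rule for `negMulLog` produces the same `negMulLog c` term in both parts, and these
cancel. -/
theorem outcomeInfo_smul {X : Type*} [Fintype X] (P : Dist X) (W : CQChannel H X) (c : ℝ)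
    (E : H →ₗ[ℂ] H) : outcomeInfo P W ((c : ℂ) • E) = c * outcomeInfo P W E := by
  simp only [outcomeInfo, mul_smul_comm, map_smul, smul_eq_mul, Complex.re_ofReal_mul]
  set t : X → ℝ := fun x => (LinearMap.trace ℂ H ((W x).op * E)).re
  have h1 : ∑ x, P x * (c * t x) = c * ∑ x, P x * t x := by
    rw [Finset.mul_sum]
    exact Finset.sum_congr rfl fun x _ => mul_left_comm _ _ _
  have h2 : ∑ x, P x * Real.negMulLog (c * t x) =
      (∑ x, P x * t x) * Real.negMulLog c + c * ∑ x, P x * Real.negMulLog (t x) := by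
    rw [Finset.mul_sum, Finset.sum_mul, ← Finset.sum_add_distrib]
    refine Finset.sum_congr rfl fun x _ => ?_
    rw [Real.negMulLog_mul]
    ring
  rw [h1, h2, Real.negMulLog_mul]
  ring

variable [FiniteDimensional ℂ H]

/-! ### Existence of the maximum `C(W)` -/

/-- The von Neumann entropy is at most the Shannon entropy of the diagonal in any orthonormal
basis. -/
theorem vonNeumannEntropy_le_entropySum_diag (ρ : State H)
    (g : OrthonormalBasis (Fin (Module.finrank ℂ H)) ℂ H) :
    vonNeumannEntropy ρ ≤ entropySum fun i => (inner ℂ (g i) (ρ.op (g i))).re := by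
  rw [vonNeumannEntropy, entropySum_eq_sum_negMulLog, entropySum_eq_sum_negMulLog]
  refine div_le_div_of_nonneg_right ?_ (Real.log_nonneg one_le_two)
  set e := ρ.pos.isSymmetric.eigenvectorBasis rfl with he
  set r := ρ.pos.isSymmetric.eigenvalues rfl with hr
  -- Jensen for the concave `negMulLog`; the weights `|⟨eⱼ,gᵢ⟩|²` are doubly stochastic.
  have h1 : ∀ i, ∑ j, ‖inner ℂ (e j) (g i)‖ ^ 2 * Real.negMulLog (r j) ≤
      Real.negMulLog (inner ℂ (g i) (ρ.op (g i))).re := by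
    intro i
    rw [re_inner_apply_self_eq_sum_eigenvalues ρ.pos.isSymmetric rfl (g i)]
    refine Real.concaveOn_negMulLog.le_map_sum (fun j _ => by positivity) ?_
      (fun j _ => ρ.pos.nonneg_eigenvalues rfl j)
    rw [e.sum_sq_norm_inner_right, g.orthonormal.1 i, one_pow]
  refine le_trans (le_of_eq ?_) (Finset.sum_le_sum fun i _ => h1 i)
  rw [Finset.sum_comm]
  refine Finset.sum_congr rfl fun j _ => ?_
  rw [← Finset.sum_mul, g.sum_sq_norm_inner_left, e.orthonormal.1 j, one_pow, one_mul]

theorem vonNeumannEntropy_eq_entropySum_diag (ρ : State H) :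
    vonNeumannEntropy ρ = entropySum fun i =>
      (inner ℂ (ρ.pos.isSymmetric.eigenvectorBasis rfl i)
        (ρ.op (ρ.pos.isSymmetric.eigenvectorBasis rfl i))).re := by
  rw [vonNeumannEntropy]
  congr 1
  funext i
  rw [LinearMap.IsSymmetric.apply_eigenvectorBasis, inner_smul_right, inner_self_eq_norm_sq_to_K]
  simp

/-- Fixing the eigenbasis of the average state at `P₀` gives a continuous majorant of `I(·;W)` that
touches it at `P₀`. This avoids continuity of eigenvalues. -/
theorem upperSemicontinuous_mutualInfo {X : Type*} [Fintype X] (W : CQChannel H X) :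
    UpperSemicontinuous fun P : Dist X => mutualInfo P W := by
  intro P₀ t ht
  set g := (averageState P₀ W).pos.isSymmetric.eigenvectorBasis rfl with hg
  set F : Dist X → ℝ := fun P =>
    (entropySum fun i => (inner ℂ (g i) ((averageState P W).op (g i))).re) -
      ∑ x, P x * vonNeumannEntropy (W x) with hF
  have hcont : Continuous F := by
    refine Continuous.sub (continuous_entropySum.comp (continuous_pi fun i => ?_))
      (continuous_finsetSum _ fun x _ => (Dist.continuous_apply x).mul_const _)
    have : ∀ P : Dist X, (inner ℂ (g i) ((averageState P W).op (g i))).re =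
        ∑ x, P x * (inner ℂ (g i) ((W x).op (g i))).re := by
      intro P
      simp only [averageState, LinearMap.sum_apply, LinearMap.smul_apply, inner_sum,
        inner_smul_right, Complex.re_sum, Complex.re_ofReal_mul]
    simp only [this]
    exact continuous_finsetSum _ fun x _ => (Dist.continuous_apply x).mul_const _
  have h0 : F P₀ < t := by
    have : F P₀ = mutualInfo P₀ W := by
      rw [mutualInfo, vonNeumannEntropy_eq_entropySum_diag]
    rwa [this]
  filter_upwards [hcont.continuousAt.eventually_lt continuousAt_const h0] with P hP
  exact lt_of_le_of_lt (sub_le_sub_right (vonNeumannEntropy_le_entropySum_diag _ g) _) hP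

theorem exists_isGreatest_infoValues {X : Type*} [Fintype X] [Nonempty X] (W : CQChannel H X) :
    ∃ r, IsGreatest (infoValues W) r := by
  obtain ⟨P, -, hP⟩ := UpperSemicontinuousOn.exists_isMaxOn (Set.univ_nonempty (α := Dist X))
    isCompact_univ ((upperSemicontinuous_mutualInfo W).upperSemicontinuousOn _)
  refine ⟨mutualInfo P W, ⟨P, rfl⟩, ?_⟩
  rintro _ ⟨P', rfl⟩
  exact hP (Set.mem_univ P')

/-! ### Existence of the maximum `C₁` -/

/-- Carathéodory's theorem for observables: the sum over the outcomes of a positively homogeneous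
function is also attained by an observable with a bounded number of outcomes. -/
theorem exists_observable_outcomeBound {Y : Type*} [Fintype Y] [Nonempty Y] (D : Observable H Y)
    (g : (H →ₗ[ℂ] H) → ℝ) (hg : ∀ (c : ℝ) (E : H →ₗ[ℂ] H), 0 ≤ c → g ((c : ℂ) • E) = c * g E) :
    ∃ D' : Observable H (Fin (outcomeBound H)), ∑ y, g (D'.op y) = ∑ y, g (D.op y) := by
  have hcoe : ∀ (c : ℝ) (E : H →ₗ[ℂ] H), c • E = (c : ℂ) • E := fun c E => by
    ext v; simp
  have : FiniteDimensional ℝ (H →ₗ[ℂ] H) := FiniteDimensional.trans ℝ ℂ _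
  set k : ℝ := (Fintype.card Y : ℝ) with hk
  have hk0 : 0 < k := Nat.cast_pos.2 Fintype.card_pos
  -- Scaling by `k = |Y|` turns the sum over outcomes into an average, hence a convex combination.
  set v : Y → (H →ₗ[ℂ] H) × ℝ := fun y => k • (D.op y, g (D.op y)) with hv
  have hmem : ((1 : H →ₗ[ℂ] H), ∑ y, g (D.op y)) ∈ convexHull ℝ (Set.range v) := by
    have : ((1 : H →ₗ[ℂ] H), ∑ y, g (D.op y)) = ∑ y, k⁻¹ • v y := by
      simp only [hv, smul_smul, inv_mul_cancel₀ hk0.ne', one_smul]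
      rw [← D.sum_eq_one, Prod.ext_iff]
      simp [Prod.fst_sum, Prod.snd_sum]
    rw [this]
    refine (convex_convexHull ℝ _).sum_mem (fun _ _ => inv_nonneg.2 hk0.le) ?_
      fun y _ => subset_convexHull ℝ _ ⟨y, rfl⟩
    rw [Finset.sum_const, Finset.card_univ, nsmul_eq_mul, ← hk, mul_inv_cancel₀ hk0.ne']
  obtain ⟨ι, _, z, w, hz, hind, hw, -, hsum⟩ := eq_pos_convex_span_of_mem_convexHull hmem
  have hcard : Fintype.card ι ≤ Fintype.card (Fin (outcomeBound H)) := by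
    rw [Fintype.card_fin]
    exact hind.card_le_finrank_succ.trans (Nat.succ_le_succ (Submodule.finrank_le _))
  obtain ⟨φ⟩ := Function.Embedding.nonempty_of_card_le hcard
  choose y hy using fun i => hz ⟨i, rfl⟩
  -- Homogeneity absorbs the Carathéodory weights into the operators; unused outcomes will get the
  -- zero operator, where `g` vanishes.
  set E : ι → H →ₗ[ℂ] H := fun i => ((w i * k : ℝ) : ℂ) • D.op (y i) with hE
  have hwk : ∀ i, 0 ≤ w i * k := fun i => (mul_pos (hw i) hk0).le
  have hterm : ∀ i, w i • z i = (E i, g (E i)) := fun i => by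
    simp only [← hy, hE, hv, hg _ _ (hwk i)]
    simp only [← hcoe, smul_smul, Prod.smul_mk, smul_eq_mul, mul_assoc]
  simp only [hterm, Prod.ext_iff, Prod.fst_sum, Prod.snd_sum] at hsum
  have hext : ∀ i, Function.extend φ E 0 (φ i) = E i := fun i => φ.injective.extend_apply _ _ _
  have hext0 : ∀ j, j ∉ Set.range φ → Function.extend φ E 0 j = 0 := fun j hj =>
    Function.extend_apply' _ _ _ hj
  have hg0 : g 0 = 0 := by simpa using hg 0 0 le_rfl
  refine ⟨⟨Function.extend φ E 0, fun j => ?_, ?_⟩, ?_⟩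
  · by_cases hj : j ∈ Set.range φ
    · obtain ⟨i, rfl⟩ := hj
      rw [hext]
      exact (D.pos _).smul_of_nonneg (by exact_mod_cast hwk i)
    · rw [hext0 j hj]
      exact LinearMap.isPositive_zero
  · rw [← hsum.1]
    exact (Fintype.sum_of_injective φ φ.injective _ _ hext0 fun i => (hext i).symm).symm
  · refine Eq.trans ?_ hsum.2
    refine (Fintype.sum_of_injective φ φ.injective _ _ (fun j hj => ?_) fun i => ?_).symm
    · exact (congrArg g (hext0 j hj)).trans hg0
    · exact congrArg g (hext i).symm

theorem classicalMutualInfo_measure_eq {X Y : Type*} [Fintype X] [Fintype Y] (P : Dist X)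
    (W : CQChannel H X) (D : Observable H Y) :
    classicalMutualInfo P (measure D W) = (∑ y, outcomeInfo P W (D.op y)) / Real.log 2 := by
  simp only [classicalMutualInfo, shannonEntropy, entropySum_eq_sum_negMulLog, outcomeInfo,
    Finset.sum_sub_distrib, sub_div, mul_div_assoc', ← Finset.sum_div, Finset.mul_sum]
  rw [Finset.sum_comm]
  rfl

/-- The conditions are closed, and `0 ≤ E y ≤ 1` bounds each norm. -/
theorem isCompact_observables (n : ℕ) :
    IsCompact {E : Fin n → H →L[ℂ] H | (∀ y, 0 ≤ E y) ∧ ∑ y, E y = 1} := by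
  have := FiniteDimensional.complete ℂ H
  have := FiniteDimensional.proper ℂ (H →L[ℂ] H)
  refine Metric.isCompact_of_isClosed_isBounded ?_ ?_
  · refine IsClosed.inter ?_ (isClosed_eq (by fun_prop) continuous_const)
    have h : IsClosed (⋂ y, {E : Fin n → H →L[ℂ] H | 0 ≤ E y}) :=
      isClosed_iInter fun y => isClosed_le continuous_const (continuous_apply y)
    rwa [← Set.ofPred_forall] at h
  · refine (Metric.isBounded_closedBall (x := (0 : Fin n → H →L[ℂ] H))
      (r := ‖(1 : H →L[ℂ] H)‖)).subset ?_
    rintro E ⟨hE, hE1⟩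
    rw [mem_closedBall_zero_iff, pi_norm_le_iff_of_nonneg (norm_nonneg _)]
    intro y
    refine CStarAlgebra.norm_le_norm_of_nonneg_of_le (hE y) ?_
    rw [← hE1]
    exact Finset.single_le_sum (fun y _ => hE y) (Finset.mem_univ y)

theorem exists_isGreatest_measuredInfoValues {X : Type*} [Fintype X] [Nonempty X]
    (W : CQChannel H X) : ∃ r, IsGreatest (measuredInfoValues W) r := by
  set N := outcomeBound H with hN
  set K := {E : Fin N → H →L[ℂ] H | (∀ y, 0 ≤ E y) ∧ ∑ y, E y = 1} with hK
  have htoK : ∀ D : Observable H (Fin N),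
      (fun y => LinearMap.toContinuousLinearMap (D.op y)) ∈ K := by
    intro D
    refine ⟨fun y => ?_, ?_⟩
    · rw [ContinuousLinearMap.nonneg_iff_isPositive,
        LinearMap.isPositive_toContinuousLinearMap_iff]
      exact D.pos y
    · rw [← map_sum, D.sum_eq_one]
      rfl
  set F : Dist X × (Fin N → H →L[ℂ] H) → ℝ := fun q =>
    (∑ y, outcomeInfo q.1 W (q.2 y : H →ₗ[ℂ] H)) / Real.log 2 with hF
  have hcont : Continuous F := by
    have htr : ∀ x y, Continuous fun q : Dist X × (Fin N → H →L[ℂ] H) =>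
        (LinearMap.trace ℂ H ((W x).op * (q.2 y : H →ₗ[ℂ] H))).re := by
      intro x y
      have h1 : Continuous (LinearMap.trace ℂ H ∘ₗ LinearMap.mulLeft ℂ (W x).op ∘ₗ
          (ContinuousLinearMap.coeLM ℂ : (H →L[ℂ] H) →ₗ[ℂ] H →ₗ[ℂ] H)) :=
        LinearMap.continuous_of_finiteDimensional _
      exact Complex.continuous_re.comp (h1.comp ((continuous_apply y).comp continuous_snd))
    have hP : ∀ x, Continuous fun q : Dist X × (Fin N → H →L[ℂ] H) => q.1 x := fun x =>
      (Dist.continuous_apply x).comp continuous_fst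
    refine (continuous_finsetSum _ fun y _ => ?_).div_const _
    exact (Real.continuous_negMulLog.comp
        (continuous_finsetSum _ fun x _ => (hP x).mul (htr x y))).sub
      (continuous_finsetSum _ fun x _ => (hP x).mul (Real.continuous_negMulLog.comp (htr x y)))
  have hred : ∀ (k : ℕ) (P : Dist X) (D : Observable H (Fin k)), ∃ E ∈ K,
      F (P, E) = classicalMutualInfo P (measure D W) := by
    intro k P D
    -- With no outcomes, `1 = 0` on `H`, contradicting that a state has trace one.
    have hk : Nonempty (Fin k) := by
      by_contra hcon
      rw [not_nonempty_iff] at hcon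
      have h1 := D.sum_eq_one
      rw [Finset.univ_eq_empty, Finset.sum_empty] at h1
      obtain ⟨x⟩ := ‹Nonempty X›
      have h2 := (W x).trace_eq_one
      rw [← mul_one (W x).op, ← h1, mul_zero, map_zero] at h2
      exact zero_ne_one h2
    obtain ⟨D', hD'⟩ := exists_observable_outcomeBound D (outcomeInfo P W)
      fun c E _ => outcomeInfo_smul P W c E
    refine ⟨_, htoK D', ?_⟩
    rw [classicalMutualInfo_measure_eq, ← hD']
    rfl
  have hne : (Set.univ ×ˢ K : Set (Dist X × (Fin N → H →L[ℂ] H))).Nonempty := by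
    obtain ⟨P⟩ := (inferInstance : Nonempty (Dist X))
    obtain ⟨E, hE, -⟩ := hred 1 P ⟨fun _ => 1, fun _ => LinearMap.isPositive_one, by simp⟩
    exact ⟨(P, E), Set.mem_univ _, hE⟩
  obtain ⟨⟨P, E⟩, ⟨-, hE⟩, hmax⟩ :=
    (isCompact_univ.prod (isCompact_observables N)).exists_isMaxOn hne hcont.continuousOn
  refine ⟨F (P, E), ⟨N, P, ⟨fun y => (E y : H →ₗ[ℂ] H), fun y => ?_, ?_⟩, ?_⟩, ?_⟩
  · rw [ContinuousLinearMap.isPositive_toLinearMap_iff,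
      ← ContinuousLinearMap.nonneg_iff_isPositive]
    exact hE.1 y
  · have := congrArg (fun T : H →L[ℂ] H => (T : H →ₗ[ℂ] H)) hE.2
    simpa using this
  · rw [classicalMutualInfo_measure_eq]
  · rintro _ ⟨k, P', D, rfl⟩
    obtain ⟨E', hE', hEq⟩ := hred k P' D
    rw [← hEq]
    exact hmax ⟨Set.mem_univ P', hE'⟩

end Operators

end CQ

theorem mainTheorem4 {X H : Type*} [Fintype X] [Nonempty X]
    [NormedAddCommGroup H] [InnerProductSpace ℂ H] [FiniteDimensional ℂ H]
    (W : CQ.CQChannel H X) :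
    (∀ (Y : Type*) [Fintype Y] (P : CQ.Dist X) (D : CQ.Observable H Y),
      CQ.classicalMutualInfo P (CQ.measure D W) ≤ CQ.mutualInfo P W) ∧
    IsGreatest (CQ.infoValues W) (CQ.capacity W) ∧
    IsGreatest (CQ.measuredInfoValues W) (CQ.capacityOne W) ∧
    CQ.capacityOne W ≤ CQ.capacity W := by
  obtain ⟨c, hc⟩ := CQ.exists_isGreatest_infoValues W
  obtain ⟨c₁, hc₁⟩ := CQ.exists_isGreatest_measuredInfoValues W
  rw [CQ.capacity, CQ.capacityOne, hc.csSup_eq, hc₁.csSup_eq]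
  refine ⟨fun Y _ P D => CQ.classicalMutualInfo_measure_le W P D, hc, hc₁, ?_⟩
  obtain ⟨k, P, D, rfl⟩ := hc₁.1
  exact (CQ.classicalMutualInfo_measure_le W P D).trans (hc.2 ⟨P, rfl⟩)
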